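/- Let $(X,\mu)$ be a standard Borel probability space, let $d\ge 1$, and let $T_1,\dots,T_d$ be commuting measure preserving transformations of $(X,\mu)$. For a measure preserving transformation $S$ of a standard Borel probability space $(Y,\nu)$, let $\mathcal I(S)$ be the $\sigma$-algebra of measurable $S$-invariant sets, and let $\nu\times_{\mathcal I(S)}\nu$ be the probability measure on $Y\times Y$ characterized by $$\int f(y)f'(y')\,d(\nu\times_{\mathcal I(S)}\nu)(y,y')=\int \mathbb E_\nu(f\mid\mathcal I(S))\,\mathbb E_\nu(f'\mid\mathcal I(S))\,d\nu$$ for all bounded measurable $f,f'$ on $Y$. Define probability measures $\mu_k$ on $X^{2^k}$, whose points are written $x=(x_\epsilon\colon\epsilon\in\{0,1\}^k)$, by $\mu_0=\mu$ and $$\mu_{k+1}=\mu_k\times_{\mathcal I(T_{k+1}\times\dots\times T_{k+1})}\mu_k\qquad(0\le k<d),$$ where $(x',x'')\in X^{2^k}\times X^{2^k}$ is identified with the point $x\in X^{2^{k+1}}$ such that $x_{\eta0}=x'_\eta$ and $x_{\eta1}=x''_\eta$ for $\eta\in\{0,1\}^k$. Let $\mu^*=\mu_d$ on $X^*=X^{2^d}$,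 and define the box seminorm of a real-valued $f\in L^\infty(\mu)$ by $$|||f|||=\Bigl(\int\prod_{\epsilon\in\{0,1\}^d}f(x_\epsilon)\,d\mu^*(x)\Bigr)^{1/2^d}.$$ Write $\emptyset=00\cdots0\in\{0,1\}^d$, and write each $x\in X^*$ as $x=(x_\emptyset,x^\sharp)$ with $x^\sharp=(x_\epsilon\colon\epsilon\ne\emptyset)\in X^\sharp=X^{2^d-1}$. Let $\mathcal Z$ be the $\sigma$-algebra on $X$ consisting of the measurable sets $B\subset X$ for which there is a measurable set $A\subset X^\sharp$ such that $$\mathbf 1_B(x_\emptyset)=\mathbf 1_A(x^\sharp)\quad\text{for }\mu^*\text{-almost every }x=(x_\emptyset,x^\sharp)\in X^*.$$ Then $\mathcal Z$ is a characteristic $\sigma$-algebra for the box seminorm, in the following sense: for every $f\in L^\infty(\mu)$, $$|||f|||=0\quad\text{if and only if}\quad \mathbb E_\mu(f\mid\mathcal Z)=0 .$$ -/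

import Mathlib

open MeasureTheory ProbabilityTheory
open scoped ENNReal

namespace BoxSeminorm

/-- The conditionally independent square `ν ×_{I(S)} ν` on `Y × Y`, where `I(S)` is the σ-algebra of
`S`-invariant measurable sets: `∫ κ_y × κ_y dν(y)`, with `κ` the regular conditional probability of
`ν` given `I(S)`. The characterizing integral formula is `integral_condIndepSquare` below. -/
noncomputable def condIndepSquare {Y : Type*} [MeasurableSpace Y] [StandardBorelSpace Y]
    (ν : Measure Y) [IsFiniteMeasure ν] (S : Y → Y) : Measure (Y × Y) :=
  ν.bind fun y =>
    (condExpKernel ν (MeasurableSpace.invariants S) y).prod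
      (condExpKernel ν (MeasurableSpace.invariants S) y)

section

variable {Y : Type*} [MeasurableSpace Y] [StandardBorelSpace Y]

theorem measurable_condIndepSquare_aux (ν : Measure Y) [IsFiniteMeasure ν] (S : Y → Y) :
    Measurable fun y =>
      (condExpKernel ν (MeasurableSpace.invariants S) y).prod
        (condExpKernel ν (MeasurableSpace.invariants S) y) := by
  have h := (condExpKernel ν (MeasurableSpace.invariants S) ×ₖ
    condExpKernel ν (MeasurableSpace.invariants S)).measurable
  have h' := h.mono (MeasurableSpace.invariants_le S) le_rfl
  convert h' using 2 with y
  rw [Kernel.prod_apply]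

instance isProbabilityMeasure_condIndepSquare (ν : Measure Y) [IsProbabilityMeasure ν]
    (S : Y → Y) : IsProbabilityMeasure (condIndepSquare ν S) :=
  isProbabilityMeasure_bind (measurable_condIndepSquare_aux ν S).aemeasurable
    (Filter.Eventually.of_forall fun _ => inferInstance)

theorem integral_condIndepSquare (ν : Measure Y) [IsProbabilityMeasure ν] (S : Y → Y)
    {f g : Y → ℝ} (hf : Measurable f) (hg : Measurable g) {C D : ℝ}
    (hfC : ∀ y, |f y| ≤ C) (hgD : ∀ y, |g y| ≤ D) :
    ∫ p, f p.1 * g p.2 ∂(condIndepSquare ν S) =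
      ∫ y, (ν[f | MeasurableSpace.invariants S]) y *
        (ν[g | MeasurableSpace.invariants S]) y ∂ν := by
  have hle := MeasurableSpace.invariants_le S
  have hfi : Integrable f ν :=
    .of_bound hf.aestronglyMeasurable C (.of_forall fun y => by simpa using hfC y)
  have hgi : Integrable g ν :=
    .of_bound hg.aestronglyMeasurable D (.of_forall fun y => by simpa using hgD y)
  have hC : Integrable (fun p : Y × Y => f p.1 * g p.2) (condIndepSquare ν S) := by
    refine .of_bound (by fun_prop) (C * D) (.of_forall fun p => ?_)
    rw [norm_mul]
    exact mul_le_mul (hfC _) (hgD _) (norm_nonneg _) ((abs_nonneg _).trans (hfC p.1))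
  have h1 : ∫ p, f p.1 * g p.2 ∂(condIndepSquare ν S) =
      ∫ y, ∫ p, f p.1 * g p.2 ∂((condExpKernel ν (MeasurableSpace.invariants S) y).prod
        (condExpKernel ν (MeasurableSpace.invariants S) y)) ∂ν :=
    Kernel.integral_comp (κ := Kernel.const Unit ν) (a := ())
      (η := (⟨_, measurable_condIndepSquare_aux ν S⟩ : Kernel Y (Y × Y))) hC
  rw [h1]
  refine integral_congr_ae ?_
  filter_upwards [condExp_ae_eq_integral_condExpKernel hle hfi,
    condExp_ae_eq_integral_condExpKernel hle hgi] with y h2 h3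
  rw [h2, h3]
  exact integral_prod_mul _ _

end

/-- The identification of `X^{2^k} × X^{2^k}` with `X^{2^{k+1}}`: the pair `(x', x'')` is the point
`x` with `x_{η0} = x'_η` and `x_{η1} = x''_η`. -/
def glue {X : Type*} {k : ℕ} (p : ((Fin k → Bool) → X) × ((Fin k → Bool) → X)) :
    (Fin (k + 1) → Bool) → X :=
  fun ε => if ε (Fin.last k) then p.2 (Fin.init ε) else p.1 (Fin.init ε)

theorem measurable_glue {X : Type*} [MeasurableSpace X] {k : ℕ} :
    Measurable (glue : ((Fin k → Bool) → X) × ((Fin k → Bool) → X) → _) := by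
  refine measurable_pi_lambda _ fun ε => ?_
  unfold glue
  split_ifs <;> fun_prop

/-- The diagonal transformation `S × ⋯ × S` of `X^{2^k}`. -/
def diag {X : Type*} (k : ℕ) (S : X → X) (x : (Fin k → Bool) → X) : (Fin k → Bool) → X :=
  fun ε => S (x ε)

section

variable {X : Type*} [MeasurableSpace X] [StandardBorelSpace X]

/-- The measures `μ_{T_1,…,T_k}` on `X^{2^k}` (bundled as probability measures), starting from `μ`
on `X = X^{2^0}`, with
`μ_{T_1,…,T_{k+1}} = μ_{T_1,…,T_k} ×_{I(T_{k+1} × ⋯ × T_{k+1})} μ_{T_1,…,T_k}`. -/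
noncomputable def boxProbabilityMeasure (μ : Measure X) [IsProbabilityMeasure μ] :
    (k : ℕ) → (Fin k → X → X) → ProbabilityMeasure ((Fin k → Bool) → X)
  | 0, _ => ⟨μ.map fun x _ => x,
      Measure.isProbabilityMeasure_map
        (measurable_pi_lambda _ fun _ => measurable_id).aemeasurable⟩
  | k + 1, T =>
    ⟨(condIndepSquare
        (boxProbabilityMeasure μ k fun i => T i.castSucc : Measure ((Fin k → Bool) → X))
        (diag k (T (Fin.last k)))).map glue,
      Measure.isProbabilityMeasure_map measurable_glue.aemeasurable⟩

/-- The box measure `μ^* = μ_{T_1,…,T_d}` on `X^* = X^{2^d}`. -/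
noncomputable def boxMeasure (μ : Measure X) [IsProbabilityMeasure μ] {d : ℕ} (T : Fin d → X → X) :
    Measure ((Fin d → Bool) → X) :=
  (boxProbabilityMeasure μ d T : Measure ((Fin d → Bool) → X))

/-- The box seminorm `|||f|||` associated to `T_1,…,T_d`. -/
noncomputable def boxSeminorm (μ : Measure X) [IsProbabilityMeasure μ] {d : ℕ} (T : Fin d → X → X)
    (f : X → ℝ) : ℝ :=
  (∫ x, ∏ ε : Fin d → Bool, f (x ε) ∂(boxMeasure μ T)) ^ ((1 : ℝ) / 2 ^ d)

/-- The index `∅ = 00…0`. -/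
def zeroIndex (d : ℕ) : Fin d → Bool := fun _ => false

/-- `X^♯ = X^{2^d - 1}`, with coordinates indexed by `ε ≠ ∅`. -/
abbrev Sharp (d : ℕ) (X : Type*) : Type _ := {ε : Fin d → Bool // ε ≠ zeroIndex d} → X

/-- The projection `x ↦ x^♯`. -/
def sharp {d : ℕ} {X : Type*} (x : (Fin d → Bool) → X) : Sharp d X := fun ε => x ε.1

/-- `1_B(x_∅) = 1_A(x^♯)` for `μ^*`-almost every `x`. -/
def AgreesWith (μ : Measure X) [IsProbabilityMeasure μ] {d : ℕ} (T : Fin d → X → X)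
    (B : Set X) (A : Set (Sharp d X)) : Prop :=
  ∀ᵐ x ∂(boxMeasure μ T),
    B.indicator (1 : X → ℝ) (x (zeroIndex d)) = A.indicator (1 : Sharp d X → ℝ) (sharp x)

theorem agreesWith_iff (μ : Measure X) [IsProbabilityMeasure μ] {d : ℕ} (T : Fin d → X → X)
    (B : Set X) (A : Set (Sharp d X)) :
    AgreesWith μ T B A ↔ ∀ᵐ x ∂(boxMeasure μ T), x (zeroIndex d) ∈ B ↔ sharp x ∈ A := by
  classical
  refine Filter.eventually_congr (.of_forall fun x => ?_)
  by_cases h1 : x (zeroIndex d) ∈ B <;> by_cases h2 : sharp x ∈ A <;> simp [h1, h2]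

/-- The σ-algebra `Z` on `X` of the measurable sets `B` such that `1_B(x_∅)` agrees
`μ^*`-almost everywhere with `1_A(x^♯)` for some measurable `A ⊆ X^♯`. -/
def sigmaZ (μ : Measure X) [IsProbabilityMeasure μ] {d : ℕ} (T : Fin d → X → X) :
    MeasurableSpace X where
  MeasurableSet' B := MeasurableSet B ∧ ∃ A : Set (Sharp d X), MeasurableSet A ∧ AgreesWith μ T B A
  measurableSet_empty := ⟨.empty, ∅, .empty, by simp [AgreesWith]⟩
  measurableSet_compl := by
    rintro B ⟨hB, A, hA, h⟩
    refine ⟨hB.compl, Aᶜ, hA.compl, ?_⟩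
    rw [agreesWith_iff] at h ⊢
    filter_upwards [h] with x hx
    exact not_congr hx
  measurableSet_iUnion := by
    intro B hB
    choose hm A hA h using hB
    refine ⟨.iUnion hm, ⋃ i, A i, .iUnion hA, ?_⟩
    simp only [agreesWith_iff] at h ⊢
    filter_upwards [ae_all_iff.2 h] with x hx
    simp [hx]

end

end BoxSeminorm

/-!
By the Gowers–Cauchy–Schwarz inequality, if `|||f||| = 0` then `f(x_∅)` is orthogonal to every
product of indicators `1_{A_ε}(x_ε)`, `ε ≠ ∅`, hence `E(f(x_∅) | x^♯) = 0`; the converse is clear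
because `∏ f(x_ε)` is `f(x_∅)` times a function of `x^♯`. On the other hand `μ^*` is invariant under
the side transformations, which apply `T_i` to the coordinates `x_ε` with `ε_i = 1`. They fix `x_∅`
and act on `x^♯`, so `E(f(x_∅) | x^♯)` is invariant under all of them. A function of `x` with this
property depends on `x_∅` alone, by peeling off one conditionally independent square at a time.
Being also a function of `x^♯`, the conditional expectation is then `Z`-measurable in `x_∅`, so that
`E(f(x_∅) | x^♯) = E(f | Z)(x_∅)`.
-/

namespace BoxSeminorm

open Filter Topology

section Integral

variable {Ω Ω' : Type*} {mΩ : MeasurableSpace Ω} {mΩ' : MeasurableSpace Ω'} {P : Measure Ω}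
  {Q : Measure Ω'} {φ : Ω → Ω'}

theorem integral_comp_of_measurePreserving (hφ : MeasurePreserving φ P Q) {f : Ω' → ℝ}
    (hf : AEStronglyMeasurable f Q) : ∫ x, f (φ x) ∂P = ∫ y, f y ∂Q := by
  rw [← hφ.map_eq] at hf ⊢
  exact (integral_map hφ.aemeasurable hf).symm

theorem ae_eq_comp_iff_of_measurePreserving (hφ : MeasurePreserving φ P Q) {f g : Ω' → ℝ}
    (hf : AEStronglyMeasurable f Q) (hg : AEStronglyMeasurable g Q) :
    f ∘ φ =ᵐ[P] g ∘ φ ↔ f =ᵐ[Q] g := by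
  refine ⟨fun h => ?_, hφ.quasiMeasurePreserving.ae_eq_comp⟩
  have hnull := (hf.nullMeasurableSet_eq_fun hg).compl
  exact (hφ.measure_preimage hnull).symm.trans h

theorem ae_eq_of_integral_mul {f g : Ω → ℝ} (hf : MemLp f 2 P) (hg : MemLp g 2 P)
    (hff : ∫ x, f x * g x ∂P = ∫ x, f x * f x ∂P) (hgg : ∫ x, f x * g x ∂P = ∫ x, g x * g x ∂P) :
    f =ᵐ[P] g := by
  have hexpand : (f - g) * (f - g) = f * f - f * g - (f * g - g * g) := by ring
  have hint : ∫ x, (f - g) x * (f - g) x ∂P = 0 := by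
    change ∫ x, ((f - g) * (f - g)) x ∂P = 0
    rw [hexpand, integral_sub' ((hf.integrable_mul hf).sub (hf.integrable_mul hg))
      ((hf.integrable_mul hg).sub (hg.integrable_mul hg)),
      integral_sub' (hf.integrable_mul hf) (hf.integrable_mul hg),
      integral_sub' (hf.integrable_mul hg) (hg.integrable_mul hg)]
    simp only [Pi.mul_apply]
    linarith
  rw [integral_eq_zero_iff_of_nonneg (fun x => mul_self_nonneg _)
    ((hf.sub hg).integrable_mul (hf.sub hg))] at hint
  filter_upwards [hint] with x hx
  exact sub_eq_zero.1 (mul_self_eq_zero.1 hx)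

theorem exists_measurable_bounded_ae_eq {f : Ω → ℝ} (hf : MemLp f ∞ P) :
    ∃ (g : Ω → ℝ) (C : ℝ), Measurable g ∧ (∀ x, |g x| ≤ C) ∧ f =ᵐ[P] g := by
  set C := lpNorm f ∞ P
  have hC : 0 ≤ C := lpNorm_nonneg
  refine ⟨fun x => max (-C) (min C (hf.1.mk f x)), C,
    measurable_const.max (measurable_const.min hf.1.stronglyMeasurable_mk.measurable),
    fun x => abs_le.2 ⟨le_max_left _ _, max_le (by linarith) (min_le_left _ _)⟩, ?_⟩
  filter_upwards [hf.1.ae_eq_mk, ae_le_lpNorm_exponent_top hf] with x hmk hle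
  rw [Real.norm_eq_abs, abs_le] at hle
  rw [← hmk, min_eq_right hle.2, max_eq_right hle.1]

end Integral

section CondExp

variable {Ω : Type*} {m mΩ : MeasurableSpace Ω} {P : Measure Ω} [IsFiniteMeasure P]
  {f g : Ω → ℝ}

theorem integral_condExp_mul (hm : m ≤ mΩ) (hf : Integrable f P)
    (hg : AEStronglyMeasurable[m] g P) (hfg : Integrable (f * g) P) :
    ∫ x, (P[f | m]) x * g x ∂P = ∫ x, f x * g x ∂P :=
  (integral_congr_ae (condExp_mul_of_aestronglyMeasurable_right hg hfg hf).symm).trans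
    (integral_condExp hm)

theorem integral_mul_eq_zero_of_condExp_ae_eq_zero (hm : m ≤ mΩ) (hf : Integrable f P)
    (hcond : P[f | m] =ᵐ[P] 0) (hg : AEStronglyMeasurable[m] g P) (hfg : Integrable (f * g) P) :
    ∫ x, f x * g x ∂P = 0 := by
  rw [← integral_condExp_mul hm hf hg hfg]
  refine integral_eq_zero_of_ae ?_
  filter_upwards [hcond] with x hx
  simp [hx]

theorem integral_condExp_mul_comm (hm : m ≤ mΩ) (hf : MemLp f 2 P) (hg : MemLp g 2 P) :
    ∫ x, (P[f | m]) x * g x ∂P = ∫ x, f x * (P[g | m]) x ∂P := by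
  have hf' := hf.condExp (m := m) one_le_two
  have hg' := hg.condExp (m := m) one_le_two
  calc ∫ x, (P[f | m]) x * g x ∂P = ∫ x, g x * (P[f | m]) x ∂P := by simp_rw [mul_comm]
    _ = ∫ x, (P[g | m]) x * (P[f | m]) x ∂P :=
      (integral_condExp_mul hm (hg.integrable one_le_two)
        stronglyMeasurable_condExp.aestronglyMeasurable (hg.integrable_mul hf')).symm
    _ = ∫ x, (P[f | m]) x * (P[g | m]) x ∂P := by simp_rw [mul_comm]
    _ = ∫ x, f x * (P[g | m]) x ∂P :=
      integral_condExp_mul hm (hf.integrable one_le_two)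
        stronglyMeasurable_condExp.aestronglyMeasurable (hf.integrable_mul hg')

theorem condExp_comp_ae_eq_of_comp_ae_eq (hm : m ≤ mΩ) {R : Ω → Ω} (hR : MeasurePreserving R P P)
    (hRm : Measurable[m, m] R) (hf : MemLp f 2 P) (hinv : f ∘ R =ᵐ[P] f) :
    (P[f | m]) ∘ R =ᵐ[P] P[f | m] := by
  set Φ := P[f | m]
  have hΦ : MemLp Φ 2 P := hf.condExp one_le_two
  have hΦR : MemLp (Φ ∘ R) 2 P := hΦ.comp_measurePreserving hR
  have hΦm : StronglyMeasurable[m] Φ := stronglyMeasurable_condExp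
  have hfi := hf.integrable one_le_two
  have hsq : ∫ x, Φ (R x) * Φ (R x) ∂P = ∫ x, Φ x * Φ x ∂P :=
    integral_comp_of_measurePreserving hR (hΦ.1.mul hΦ.1)
  have hcross : ∫ x, Φ x * Φ (R x) ∂P = ∫ x, Φ x * Φ x ∂P :=
    calc ∫ x, Φ x * Φ (R x) ∂P = ∫ x, f x * Φ (R x) ∂P :=
          integral_condExp_mul hm hfi (hΦm.comp_measurable hRm).aestronglyMeasurable
            (hf.integrable_mul hΦR)
      _ = ∫ x, f (R x) * Φ (R x) ∂P := integral_congr_ae (hinv.symm.mul .rfl)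
      _ = ∫ x, f x * Φ x ∂P := integral_comp_of_measurePreserving hR (hf.1.mul hΦ.1)
      _ = ∫ x, Φ x * Φ x ∂P :=
          (integral_condExp_mul hm hfi hΦm.aestronglyMeasurable (hf.integrable_mul hΦ)).symm
  exact (ae_eq_of_integral_mul hΦ hΦR hcross (hcross.trans hsq.symm)).symm

theorem condExp_ae_eq_zero_of_generateFrom (hm : m ≤ mΩ) {C : Set (Set Ω)} (hC : IsPiSystem C)
    (hgen : m = MeasurableSpace.generateFrom C) (hf : Integrable f P) (huniv : ∫ x, f x ∂P = 0)
    (h : ∀ s ∈ C, ∫ x in s, f x ∂P = 0) : P[f | m] =ᵐ[P] 0 := by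
  have hset : ∀ s, MeasurableSet[m] s → ∫ x in s, f x ∂P = 0 := by
    intro s hs
    induction s, hs using MeasurableSpace.induction_on_inter hgen hC with
    | empty => simp
    | basic t ht => exact h t ht
    | compl t ht ih =>
      have hsum := integral_add_compl (hm t ht) hf
      rwa [ih, huniv, zero_add] at hsum
    | iUnion t hd ht ih =>
      rw [integral_iUnion (fun i => hm _ (ht i)) hd hf.integrableOn]
      simp [ih]
  refine (ae_eq_condExp_of_forall_setIntegral_eq hm hf
    (fun s _ _ => (integrable_zero Ω ℝ P).integrableOn) (fun s hs _ => ?_)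
    aestronglyMeasurable_zero).symm
  simp [hset s hs]

end CondExp

section MeanErgodic

variable {Y : Type*} [MeasurableSpace Y] {ν : Measure Y} {S : Y → Y}

theorem aestronglyMeasurable_invariants_of_comp_ae_eq (hS : MeasurePreserving S ν ν) {w : Y → ℝ}
    (hw : AEStronglyMeasurable w ν) (hinv : w ∘ S =ᵐ[ν] w) :
    AEStronglyMeasurable[MeasurableSpace.invariants S] w ν := by
  set w' := hw.mk w
  have hw' : Measurable w' := hw.stronglyMeasurable_mk.measurable
  have hiter : ∀ n : ℕ, w' ∘ S^[n] =ᵐ[ν] w := by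
    intro n
    refine ((hS.iterate n).quasiMeasurePreserving.ae_eq_comp hw.ae_eq_mk.symm).trans ?_
    induction n with
    | zero => rfl
    | succ n ih => exact (hS.quasiMeasurePreserving.ae_eq_comp ih).trans hinv
  -- The limsup along orbits turns almost everywhere invariance into strict invariance.
  refine ⟨fun y => limsup (fun n => w' (S^[n] y)) atTop, Measurable.stronglyMeasurable ?_, ?_⟩
  · rw [MeasurableSpace.measurable_invariants_dom]
    refine ⟨.limsup fun n => hw'.comp (hS.measurable.iterate n), fun s _ => ?_⟩
    congr 1
    funext y
    exact limsup_nat_add (fun n => w' (S^[n] y)) 1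
  · filter_upwards [ae_all_iff.2 hiter] with y hy
    simp only [Function.comp_apply] at hy
    simp [hy]

theorem eqLocus_compMeasurePreserving_eq_lpMeas (hS : MeasurePreserving S ν ν) :
    (Lp.compMeasurePreservingₗᵢ ℝ S hS).toContinuousLinearMap.eqLocus
      (1 : Lp ℝ 2 ν →L[ℝ] Lp ℝ 2 ν) = lpMeas ℝ ℝ (MeasurableSpace.invariants S) 2 ν := by
  ext w
  have hcomp := Lp.coeFn_compMeasurePreserving w hS
  rw [mem_lpMeas_iff_aestronglyMeasurable]
  change Lp.compMeasurePreserving S hS w = w ↔ _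
  refine ⟨fun h => ?_, fun h => Lp.ext (hcomp.trans ?_)⟩
  · rw [h] at hcomp
    exact aestronglyMeasurable_invariants_of_comp_ae_eq hS (Lp.aestronglyMeasurable w) hcomp.symm
  · have hmk := h.ae_eq_mk
    have hmk_inv : h.mk w ∘ S = h.mk w :=
      MeasurableSpace.comp_eq_of_measurable_invariants h.stronglyMeasurable_mk.measurable
    refine (hS.quasiMeasurePreserving.ae_eq_comp hmk).trans ?_
    rw [hmk_inv]
    exact hmk.symm

theorem tendsto_birkhoffAverage_condExpL2 (hS : MeasurePreserving S ν ν) (w : Lp ℝ 2 ν) :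
    Tendsto (birkhoffAverage ℝ (Lp.compMeasurePreserving S hS) id · w) atTop
      (𝓝 (condExpL2 ℝ ℝ (MeasurableSpace.invariants_le S) w : Lp ℝ 2 ν)) := by
  set U : Lp ℝ 2 ν →ₗᵢ[ℝ] Lp ℝ 2 ν := Lp.compMeasurePreservingₗᵢ ℝ S hS with hU
  have hlim := U.toContinuousLinearMap.tendsto_birkhoffAverage_orthogonalProjection
    U.norm_toContinuousLinearMap_le w
  rw [← Submodule.starProjection_apply] at hlim
  simp only [hU, eqLocus_compMeasurePreserving_eq_lpMeas hS] at hlim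
  exact hlim

theorem condExp_invariants_comp [IsFiniteMeasure ν] {Ω : Type*} [MeasurableSpace Ω]
    {P : Measure Ω} [IsFiniteMeasure P] {π : Ω → Y} {R : Ω → Ω} (hπ : MeasurePreserving π P ν)
    (hR : MeasurePreserving R P P) (hS : MeasurePreserving S ν ν) (hsemi : Function.Semiconj π R S)
    {f : Y → ℝ} (hf : MemLp f 2 ν) :
    P[f ∘ π | MeasurableSpace.invariants R] =ᵐ[P] ν[f | MeasurableSpace.invariants S] ∘ π := by
  set W : Lp ℝ 2 ν →ₗᵢ[ℝ] Lp ℝ 2 P := Lp.compMeasurePreservingₗᵢ ℝ π hπ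
  have hfπ := hf.comp_measurePreserving hπ
  have hsemiL : Function.Semiconj W (Lp.compMeasurePreserving S hS)
      (Lp.compMeasurePreserving R hR) := fun w => by
    change Lp.compMeasurePreserving π hπ _ = Lp.compMeasurePreserving R hR
      (Lp.compMeasurePreserving π hπ w)
    simp only [← Lp.compMeasurePreserving_comp_apply, hsemi.comp_eq]
  have haverage : ∀ N, W (birkhoffAverage ℝ (Lp.compMeasurePreserving S hS) id N hf.toLp) =
      birkhoffAverage ℝ (Lp.compMeasurePreserving R hR) id N hfπ.toLp := fun N => by
    rw [map_birkhoffAverage ℝ ℝ]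
    simp only [birkhoffAverage, birkhoffSum, Function.comp_apply, id,
      (hsemiL.iterate_right _).eq]
    rfl
  have hlimW := (W.continuous.tendsto _).comp (tendsto_birkhoffAverage_condExpL2 hS hf.toLp)
  have hlim := tendsto_birkhoffAverage_condExpL2 hR hfπ.toLp
  have hWcond := tendsto_nhds_unique hlim (hlimW.congr haverage)
  refine (hfπ.condExpL2_ae_eq_condExp (𝕜 := ℝ) (MeasurableSpace.invariants_le R)).symm.trans ?_
  rw [hWcond]
  exact (Lp.coeFn_compMeasurePreserving _ hπ).trans
    (hπ.quasiMeasurePreserving.ae_eq_comp (hf.condExpL2_ae_eq_condExp (𝕜 := ℝ) _))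

theorem condExp_preimage_invariants [IsFiniteMeasure ν] {R : Y → Y}
    (hS : MeasurePreserving S ν ν) (hR : MeasurePreserving R ν ν) (hRS : Function.Commute R S)
    {A : Set Y} (hA : MeasurableSet A) :
    ν⟦R ⁻¹' A | MeasurableSpace.invariants S⟧ =ᵐ[ν]
      ν⟦A | MeasurableSpace.invariants S⟧ ∘ R :=
  condExp_invariants_comp hR hS hS hRS (memLp_indicator_const 2 hA 1 (.inr (measure_ne_top ν A)))

theorem tendsto_average_integral_iterate_mul [IsFiniteMeasure ν] (hS : MeasurePreserving S ν ν)
    {f g : Y → ℝ} (hf : MemLp f 2 ν) (hg : MemLp g 2 ν) :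
    Tendsto (fun N : ℕ => (N : ℝ)⁻¹ * ∑ n ∈ Finset.range N, ∫ y, f (S^[n] y) * g y ∂ν) atTop
      (𝓝 (∫ y, (ν[f | MeasurableSpace.invariants S]) y * g y ∂ν)) := by
  have hinner : ∀ {u w : Lp ℝ 2 ν} {u' : Y → ℝ}, u =ᵐ[ν] u' → w =ᵐ[ν] g →
      inner ℝ u w = ∫ y, u' y * g y ∂ν := fun hu hw => by
    rw [L2.inner_def]
    refine integral_congr_ae ?_
    filter_upwards [hu, hw] with y hu hw
    simp [hu, hw, mul_comm]
  have hlim := (tendsto_birkhoffAverage_condExpL2 hS hf.toLp).inner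
    (tendsto_const_nhds (x := hg.toLp)) (𝕜 := ℝ)
  rw [hinner (hf.condExpL2_ae_eq_condExp (𝕜 := ℝ) _) hg.coeFn_toLp] at hlim
  refine hlim.congr fun N => ?_
  rw [birkhoffAverage, birkhoffSum, real_inner_smul_left, sum_inner]
  congr 1
  refine Finset.sum_congr rfl fun n _ => ?_
  rw [Lp.compMeasurePreserving_iterate, Lp.toLp_compMeasurePreserving]
  exact hinner (MemLp.coeFn_toLp _) hg.coeFn_toLp

end MeanErgodic

section Square

variable {Y : Type*} {mY : MeasurableSpace Y} [StandardBorelSpace Y] {ν : Measure Y}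
  [IsProbabilityMeasure ν] {S R : Y → Y}

theorem measureReal_condIndepSquare_prod (ν : Measure Y) [IsProbabilityMeasure ν] (S : Y → Y)
    {A B : Set Y} (hA : MeasurableSet A) (hB : MeasurableSet B) :
    (condIndepSquare ν S).real (A ×ˢ B) =
      ∫ y, (ν⟦A | MeasurableSpace.invariants S⟧) y *
        (ν⟦B | MeasurableSpace.invariants S⟧) y ∂ν := by
  have hbound : ∀ (s : Set Y) (y : Y), |s.indicator (fun _ => (1 : ℝ)) y| ≤ 1 := fun s y => by
    by_cases h : y ∈ s <;> simp [h]
  rw [← integral_condIndepSquare ν S (measurable_const.indicator hA)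
    (measurable_const.indicator hB) (hbound A) (hbound B), ← integral_indicator_one (hA.prod hB)]
  exact integral_congr_ae (.of_forall fun _ => Set.indicator_prod_one)

theorem measurePreserving_fst (ν : Measure Y) [IsProbabilityMeasure ν] (S : Y → Y) :
    MeasurePreserving Prod.fst (condIndepSquare ν S) ν := by
  refine ⟨measurable_fst, Measure.ext fun A hA => ?_⟩
  rw [Measure.map_apply measurable_fst hA, ← Set.prod_univ, ← measureReal_eq_measureReal_iff,
    measureReal_condIndepSquare_prod ν S hA .univ]
  simp [condExp_const (MeasurableSpace.invariants_le S), integral_condExp,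
    MeasurableSpace.invariants_le S, integral_indicator hA]

theorem measurePreserving_snd (ν : Measure Y) [IsProbabilityMeasure ν] (S : Y → Y) :
    MeasurePreserving Prod.snd (condIndepSquare ν S) ν := by
  refine ⟨measurable_snd, Measure.ext fun A hA => ?_⟩
  rw [Measure.map_apply measurable_snd hA, ← Set.univ_prod, ← measureReal_eq_measureReal_iff,
    measureReal_condIndepSquare_prod ν S .univ hA]
  simp [condExp_const (MeasurableSpace.invariants_le S), integral_condExp,
    MeasurableSpace.invariants_le S, integral_indicator hA]

theorem measurePreserving_prodMap_of_condExp {R₁ R₂ : Y → Y} (h₁ : Measurable R₁)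
    (h₂ : Measurable R₂)
    (h : ∀ A B : Set Y, MeasurableSet A → MeasurableSet B →
      ∫ y, (ν⟦R₁ ⁻¹' A | MeasurableSpace.invariants S⟧) y *
        (ν⟦R₂ ⁻¹' B | MeasurableSpace.invariants S⟧) y ∂ν =
      ∫ y, (ν⟦A | MeasurableSpace.invariants S⟧) y *
        (ν⟦B | MeasurableSpace.invariants S⟧) y ∂ν) :
    MeasurePreserving (Prod.map R₁ R₂) (condIndepSquare ν S) (condIndepSquare ν S) := by
  have hR := h₁.prodMap h₂
  have := Measure.isProbabilityMeasure_map (μ := condIndepSquare ν S) hR.aemeasurable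
  refine ⟨hR, Measure.ext_prod fun {A B} hA hB => ?_⟩
  rw [Measure.map_apply hR (hA.prod hB), Set.preimage_prod_map_prod,
    ← measureReal_eq_measureReal_iff, measureReal_condIndepSquare_prod ν S (h₁ hA) (h₂ hB),
    measureReal_condIndepSquare_prod ν S hA hB]
  exact h A B hA hB

theorem measurePreserving_prodMap_self (hS : MeasurePreserving S ν ν)
    (hR : MeasurePreserving R ν ν) (hRS : Function.Commute R S) :
    MeasurePreserving (Prod.map R R) (condIndepSquare ν S) (condIndepSquare ν S) := by
  refine measurePreserving_prodMap_of_condExp hR.measurable hR.measurable fun A B hA hB => ?_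
  exact (integral_congr_ae ((condExp_preimage_invariants hS hR hRS hA).mul
    (condExp_preimage_invariants hS hR hRS hB))).trans
    (integral_comp_of_measurePreserving hR (integrable_condExp.1.mul integrable_condExp.1))

theorem measurePreserving_prodMap_id (hS : MeasurePreserving S ν ν) :
    MeasurePreserving (Prod.map id S) (condIndepSquare ν S) (condIndepSquare ν S) := by
  refine measurePreserving_prodMap_of_condExp measurable_id hS.measurable fun A B _ hB =>
    integral_congr_ae (EventuallyEq.mul .rfl ?_)
  have h := condExp_preimage_invariants hS hS (.refl S) hB
  rwa [MeasurableSpace.comp_eq_of_measurable_invariants stronglyMeasurable_condExp.measurable] at h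

theorem integral_condIndepSquare_of_memLp (S : Y → Y) {f g : Y → ℝ} (hf : MemLp f ∞ ν)
    (hg : MemLp g ∞ ν) : ∫ p, f p.1 * g p.2 ∂(condIndepSquare ν S) =
      ∫ y, (ν[f | MeasurableSpace.invariants S]) y *
        (ν[g | MeasurableSpace.invariants S]) y ∂ν := by
  obtain ⟨f', C, hf'm, hf'C, hff'⟩ := exists_measurable_bounded_ae_eq hf
  obtain ⟨g', D, hg'm, hg'D, hgg'⟩ := exists_measurable_bounded_ae_eq hg
  calc ∫ p, f p.1 * g p.2 ∂(condIndepSquare ν S)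
      = ∫ p, f' p.1 * g' p.2 ∂(condIndepSquare ν S) := integral_congr_ae
        (((measurePreserving_fst ν S).quasiMeasurePreserving.ae_eq_comp hff').mul
          ((measurePreserving_snd ν S).quasiMeasurePreserving.ae_eq_comp hgg'))
    _ = ∫ y, (ν[f' | MeasurableSpace.invariants S]) y *
          (ν[g' | MeasurableSpace.invariants S]) y ∂ν :=
        integral_condIndepSquare ν S hf'm hg'm hf'C hg'D
    _ = ∫ y, (ν[f | MeasurableSpace.invariants S]) y *
          (ν[g | MeasurableSpace.invariants S]) y ∂ν := integral_congr_ae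
        ((condExp_congr_ae hff'.symm).mul (condExp_congr_ae hgg'.symm))

theorem integral_condIndepSquare_eq_condExp_mul (S : Y → Y) {f g : Y → ℝ} (hf : MemLp f ∞ ν)
    (hg : MemLp g ∞ ν) : ∫ p, f p.1 * g p.2 ∂(condIndepSquare ν S) =
      ∫ y, (ν[f | MeasurableSpace.invariants S]) y * g y ∂ν := by
  have hle := MeasurableSpace.invariants_le S
  have hEf : MemLp (ν[f | MeasurableSpace.invariants S]) 2 ν :=
    (hf.mono_exponent le_top).condExp one_le_two
  have hcomm := integral_condExp_mul_comm hle hEf (hg.mono_exponent le_top)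
  rw [condExp_of_stronglyMeasurable hle stronglyMeasurable_condExp integrable_condExp] at hcomm
  rw [integral_condIndepSquare_of_memLp S hf hg, hcomm]

theorem integral_condIndepSquare_self_nonneg (S : Y → Y) {f : Y → ℝ} (hf : MemLp f ∞ ν) :
    0 ≤ ∫ p, f p.1 * f p.2 ∂(condIndepSquare ν S) := by
  rw [integral_condIndepSquare_of_memLp S hf hf]
  exact integral_nonneg fun y => mul_self_nonneg _

theorem integral_condIndepSquare_sq_le (S : Y → Y) {f g : Y → ℝ} (hf : MemLp f ∞ ν)
    (hg : MemLp g ∞ ν) (hg1 : ∀ᵐ y ∂ν, |g y| ≤ 1) :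
    (∫ p, f p.1 * g p.2 ∂(condIndepSquare ν S)) ^ 2 ≤
      ∫ p, f p.1 * f p.2 ∂(condIndepSquare ν S) := by
  rw [integral_condIndepSquare_eq_condExp_mul S hf hg, integral_condIndepSquare_of_memLp S hf hf]
  set Ef := ν[f | MeasurableSpace.invariants S]
  have hEf : MemLp Ef 2 ν := (hf.mono_exponent le_top).condExp one_le_two
  have hEfg : MemLp (Ef * g) 2 ν := hg.mul hEf
  have hJensen := variance_eq_sub hEfg ▸ variance_nonneg (Ef * g) ν
  calc (∫ y, Ef y * g y ∂ν) ^ 2 ≤ ∫ y, (Ef y * g y) ^ 2 ∂ν := sub_nonneg.1 hJensen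
    _ ≤ ∫ y, Ef y * Ef y ∂ν := by
      refine integral_mono_ae hEfg.integrable_sq (hEf.integrable_mul hEf) ?_
      filter_upwards [hg1] with y hy
      change (Ef y * g y) ^ 2 ≤ Ef y * Ef y
      rw [mul_pow, ← sq]
      exact mul_le_of_le_one_right (sq_nonneg _) ((sq_le_one_iff_abs_le_one _).2 hy)

theorem average_pow_two_pow_le {a b : ℕ → ℝ} (k : ℕ) (h : ∀ n, a n ^ 2 ^ k ≤ b n) {N : ℕ}
    (hN : 0 < N) :
    ((N : ℝ)⁻¹ * ∑ n ∈ Finset.range N, a n) ^ 2 ^ k ≤ (N : ℝ)⁻¹ * ∑ n ∈ Finset.range N, b n := by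
  have hJensen : ((N : ℝ)⁻¹ * ∑ n ∈ Finset.range N, a n) ^ 2 ^ k ≤
      (N : ℝ)⁻¹ * ∑ n ∈ Finset.range N, a n ^ 2 ^ k := by
    rcases k.eq_zero_or_pos with rfl | hk
    · simp
    · rw [Finset.mul_sum, Finset.mul_sum]
      exact Real.pow_arith_mean_le_arith_mean_pow_of_even _ _ _ (fun _ _ => by positivity)
        (by simp [hN.ne']) (even_two.pow_of_ne_zero hk.ne')
  refine hJensen.trans ?_
  gcongr with n _
  exact h n

/- By the mean ergodic theorem both integrals are limits of averages of correlations, which reduces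
the inequality to its diagonal analogue on `Y`. -/
theorem integral_condIndepSquare_self_pow_le (hS : MeasurePreserving S ν ν) (k : ℕ) {f g : Y → ℝ}
    (hf : MemLp f ∞ ν) (hg : MemLp g ∞ ν)
    (h : ∀ n, (∫ y, f (S^[n] y) * f y ∂ν) ^ 2 ^ k ≤ ∫ y, g (S^[n] y) * g y ∂ν) :
    (∫ p, f p.1 * f p.2 ∂(condIndepSquare ν S)) ^ 2 ^ k ≤
      ∫ p, g p.1 * g p.2 ∂(condIndepSquare ν S) := by
  rw [integral_condIndepSquare_eq_condExp_mul S hf hf,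
    integral_condIndepSquare_eq_condExp_mul S hg hg]
  have hf2 : MemLp f 2 ν := hf.mono_exponent le_top
  have hg2 : MemLp g 2 ν := hg.mono_exponent le_top
  refine le_of_tendsto_of_tendsto ((tendsto_average_integral_iterate_mul hS hf2 hf2).pow (2 ^ k))
    (tendsto_average_integral_iterate_mul hS hg2 hg2) ?_
  filter_upwards [eventually_gt_atTop 0] with N hN
  exact average_pow_two_pow_le k h hN

theorem comp_fst_ae_eq_comp_snd {h : Y → ℝ} (hh : MemLp h ∞ ν)
    (hinv : AEStronglyMeasurable[MeasurableSpace.invariants S] h ν) :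
    h ∘ Prod.fst =ᵐ[condIndepSquare ν S] h ∘ Prod.snd := by
  have hfst := measurePreserving_fst ν S
  have hsnd := measurePreserving_snd ν S
  have hh2 : MemLp h 2 ν := hh.mono_exponent le_top
  have hcross : ∫ p, h p.1 * h p.2 ∂(condIndepSquare ν S) = ∫ y, h y * h y ∂ν := by
    rw [integral_condIndepSquare_eq_condExp_mul S hh hh]
    exact integral_congr_ae ((condExp_of_aestronglyMeasurable' (MeasurableSpace.invariants_le S)
      hinv (hh2.integrable one_le_two)).mul .rfl)
  refine ae_eq_of_integral_mul (hh2.comp_measurePreserving hfst)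
    (hh2.comp_measurePreserving hsnd) (hcross.trans ?_) (hcross.trans ?_)
  · exact (integral_comp_of_measurePreserving hfst (hh.1.mul hh.1)).symm
  · exact (integral_comp_of_measurePreserving hsnd (hh.1.mul hh.1)).symm

/- `E(g(y') | I(id × S))` is `E(g | I(S))(y')`, and the two points of the square agree on
`I(S)`-measurable functions. -/
theorem integral_comp_snd_mul (hS : MeasurePreserving S ν ν) {H : Y × Y → ℝ}
    (hH : MemLp H ∞ (condIndepSquare ν S)) (hinv : H ∘ Prod.map id S =ᵐ[condIndepSquare ν S] H)
    {g : Y → ℝ} (hg : MemLp g ∞ ν) :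
    ∫ p, g p.2 * H p ∂(condIndepSquare ν S) =
      ∫ p, (ν[g | MeasurableSpace.invariants S]) p.1 * H p ∂(condIndepSquare ν S) := by
  set Q := condIndepSquare ν S
  set R : Y × Y → Y × Y := Prod.map id S
  have hR : MeasurePreserving R Q Q := measurePreserving_prodMap_id hS
  have hsnd : MeasurePreserving Prod.snd Q ν := measurePreserving_snd ν S
  have hg2 : MemLp g 2 ν := hg.mono_exponent le_top
  have hgsnd : MemLp (g ∘ Prod.snd) 2 Q := hg2.comp_measurePreserving hsnd
  have hH2 : MemLp H 2 Q := hH.mono_exponent le_top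
  have hcond : Q[g ∘ Prod.snd | MeasurableSpace.invariants R] =ᵐ[Q]
      ν[g | MeasurableSpace.invariants S] ∘ Prod.fst :=
    (condExp_invariants_comp hsnd hR hS (fun _ => rfl) hg2).trans
      (comp_fst_ae_eq_comp_snd (hg.condExp le_top)
        stronglyMeasurable_condExp.aestronglyMeasurable).symm
  exact (integral_condExp_mul (MeasurableSpace.invariants_le R) (hgsnd.integrable one_le_two)
    (aestronglyMeasurable_invariants_of_comp_ae_eq hR hH.1 hinv)
    (hgsnd.integrable_mul hH2)).symm.trans (integral_congr_ae (hcond.mul .rfl))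

theorem setIntegral_prod_eq_zero_of_condExp_fst (hS : MeasurePreserving S ν ν) {D : Y × Y → ℝ}
    (hD : MemLp D ∞ (condIndepSquare ν S)) (hinv : D ∘ Prod.map id S =ᵐ[condIndepSquare ν S] D)
    (hcond : (condIndepSquare ν S)[D | mY.comap Prod.fst] =ᵐ[condIndepSquare ν S] 0)
    {A B : Set Y} (hA : MeasurableSet A) (hB : MeasurableSet B) :
    ∫ p in A ×ˢ B, D p ∂(condIndepSquare ν S) = 0 := by
  set Q := condIndepSquare ν S
  set w : Y → ℝ := ν⟦B | MeasurableSpace.invariants S⟧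
  have hB1 : MemLp (B.indicator fun _ => (1 : ℝ)) ∞ ν :=
    memLp_indicator_const ∞ hB 1 (.inr (measure_ne_top ν B))
  have hw : Measurable (A.indicator w) :=
    (stronglyMeasurable_condExp.measurable.mono (MeasurableSpace.invariants_le S) le_rfl).indicator
      hA
  have hw' : MemLp (A.indicator w ∘ Prod.fst) ∞ Q :=
    ((hB1.condExp le_top).indicator hA).comp_measurePreserving (measurePreserving_fst ν S)
  have hAinv : (Prod.fst ⁻¹' A).indicator D ∘ Prod.map id S =ᵐ[Q]
      (Prod.fst ⁻¹' A).indicator D := by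
    filter_upwards [hinv] with p hp
    by_cases hpA : p.1 ∈ A <;> simp_all [Set.indicator]
  calc ∫ p in A ×ˢ B, D p ∂Q
      = ∫ p, B.indicator (fun _ => (1 : ℝ)) p.2 * (Prod.fst ⁻¹' A).indicator D p ∂Q := by
        rw [← integral_indicator (hA.prod hB)]
        congr 1 with p
        by_cases hpA : p.1 ∈ A <;> by_cases hpB : p.2 ∈ B <;> simp [Set.indicator, hpA, hpB]
    _ = ∫ p, w p.1 * (Prod.fst ⁻¹' A).indicator D p ∂Q :=
        integral_comp_snd_mul hS (hD.indicator (measurable_fst hA)) hAinv hB1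
    _ = ∫ p, D p * (A.indicator w ∘ Prod.fst) p ∂Q := by
        congr 1 with p
        by_cases hpA : p.1 ∈ A <;> simp [Set.indicator, hpA, mul_comm]
    _ = 0 := integral_mul_eq_zero_of_condExp_ae_eq_zero measurable_fst.comap_le
        (hD.integrable le_top) hcond (hw.comp (comap_measurable _)).aestronglyMeasurable
        ((hw'.mul hD).integrable le_top)

theorem ae_eq_zero_of_condExp_fst (hS : MeasurePreserving S ν ν) {D : Y × Y → ℝ}
    (hD : MemLp D ∞ (condIndepSquare ν S)) (hinv : D ∘ Prod.map id S =ᵐ[condIndepSquare ν S] D)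
    (hcond : (condIndepSquare ν S)[D | mY.comap Prod.fst] =ᵐ[condIndepSquare ν S] 0) :
    D =ᵐ[condIndepSquare ν S] 0 := by
  have hDi : Integrable D (condIndepSquare ν S) := hD.integrable le_top
  have hrect : ∀ A B : Set Y, MeasurableSet A → MeasurableSet B →
      ∫ p in A ×ˢ B, D p ∂(condIndepSquare ν S) = 0 := fun A B hA hB =>
    setIntegral_prod_eq_zero_of_condExp_fst hS hD hinv hcond hA hB
  have hzero := condExp_ae_eq_zero_of_generateFrom le_rfl isPiSystem_prod generateFrom_prod.symm
    hDi (by simpa using hrect .univ .univ .univ .univ)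
    (by rintro _ ⟨A, hA, B, hB, rfl⟩; exact hrect A B hA hB)
  exact (condExp_of_aestronglyMeasurable' le_rfl hD.1 hDi).symm.trans hzero

theorem exists_ae_eq_comp_fst (hS : MeasurePreserving S ν ν) {F : Y × Y → ℝ}
    (hF : MemLp F ∞ (condIndepSquare ν S)) (hinv : F ∘ Prod.map id S =ᵐ[condIndepSquare ν S] F) :
    ∃ G : Y → ℝ, Measurable G ∧ F =ᵐ[condIndepSquare ν S] G ∘ Prod.fst := by
  set Q := condIndepSquare ν S
  have hle : mY.comap Prod.fst ≤ mY.prod mY := measurable_fst.comap_le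
  set Φ : Y × Y → ℝ := Q[F | mY.comap Prod.fst]
  have hΦm : StronglyMeasurable[mY.comap Prod.fst] Φ := stronglyMeasurable_condExp
  obtain ⟨G, hG, hΦG⟩ := hΦm.measurable.exists_eq_measurable_comp
  refine ⟨G, hG, ?_⟩
  have hFi : Integrable F Q := hF.integrable le_top
  have hDinv : (F - Φ) ∘ Prod.map id S =ᵐ[Q] F - Φ := by
    filter_upwards [hinv] with p hp
    simp only [Function.comp_apply] at hp
    simp [hΦG, hp]
  have hcond : Q[F - Φ | mY.comap Prod.fst] =ᵐ[Q] 0 := by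
    refine (condExp_sub hFi integrable_condExp _).trans ?_
    rw [condExp_of_stronglyMeasurable hle hΦm integrable_condExp, sub_self]
  rw [← hΦG]
  filter_upwards [ae_eq_zero_of_condExp_fst hS (hF.sub (hF.condExp le_top)) hDinv hcond] with p hp
  exact sub_eq_zero.1 hp

end Square

/-- The side transformation of `X^{2^k}` in the direction `i`: `S` acts on the coordinates `x_ε`
with `ε i = 1`, and the other coordinates, among them `x_∅`, are left fixed. -/
def side {X : Type*} {k : ℕ} (i : Fin k) (S : X → X) (x : (Fin k → Bool) → X) :
    (Fin k → Bool) → X :=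
  fun ε => if ε i then S (x ε) else x ε

section Glue

variable {X : Type*} {k : ℕ} {R S : X → X}

theorem semiconj_glue_diag (S : X → X) :
    Function.Semiconj glue (Prod.map (diag k S) (diag k S)) (diag (k + 1) S) := by
  intro p
  funext ε
  by_cases h : ε (Fin.last k) <;> simp [diag, glue, h]

theorem semiconj_glue_side_castSucc (i : Fin k) (S : X → X) :
    Function.Semiconj glue (Prod.map (side i S) (side i S)) (side i.castSucc S) := by
  intro p
  funext ε
  by_cases h : ε (Fin.last k) <;> by_cases h' : ε i.castSucc <;> simp [side, glue, Fin.init, h, h']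

theorem semiconj_glue_side_last (S : X → X) :
    Function.Semiconj glue (Prod.map id (diag k S)) (side (Fin.last k) S) := by
  intro p
  funext ε
  by_cases h : ε (Fin.last k) <;> simp [side, glue, diag, h]

theorem iterate_diag (S : X → X) (n : ℕ) (x : (Fin k → Bool) → X) :
    (diag k S)^[n] x = diag k S^[n] x := by
  induction n generalizing x with
  | zero => rfl
  | succ _ ih => exact ih _

theorem commute_diag (h : Function.Commute R S) : Function.Commute (diag k R) (diag k S) :=
  fun x => funext fun ε => h (x ε)

theorem commute_side_diag (i : Fin k) (h : Function.Commute R S) :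
    Function.Commute (side i R) (diag k S) := by
  intro x
  funext ε
  by_cases hε : ε i <;> simp [side, diag, hε, h.eq]

theorem side_zeroIndex (i : Fin k) (S : X → X) (x : (Fin k → Bool) → X) :
    side i S x (zeroIndex k) = x (zeroIndex k) := by
  simp [side, zeroIndex]

theorem snoc_zeroIndex_false (k : ℕ) :
    (Fin.snoc (zeroIndex k) false : Fin (k + 1) → Bool) = zeroIndex (k + 1) := by
  funext i
  refine Fin.lastCases ?_ (fun i => ?_) i <;> simp [zeroIndex]

theorem snoc_false_ne_zeroIndex {η : Fin k → Bool} (hη : η ≠ zeroIndex k) :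
    (Fin.snoc η false : Fin (k + 1) → Bool) ≠ zeroIndex (k + 1) := fun h => by
  rw [← snoc_zeroIndex_false] at h
  exact hη (Fin.snoc_injective2 h).1

theorem snoc_true_ne_zeroIndex (η : Fin k → Bool) :
    (Fin.snoc η true : Fin (k + 1) → Bool) ≠ zeroIndex (k + 1) := fun h => by
  simpa [zeroIndex] using congrFun h (Fin.last k)

theorem prod_glue {M : Type*} [CommMonoid M] (f : (Fin (k + 1) → Bool) → X → M)
    (p : ((Fin k → Bool) → X) × ((Fin k → Bool) → X)) :
    ∏ ε, f ε (glue p ε) =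
      (∏ η : Fin k → Bool, f (Fin.snoc η false) (p.1 η)) *
        ∏ η : Fin k → Bool, f (Fin.snoc η true) (p.2 η) := by
  rw [← (Fin.snocEquiv fun _ => Bool).prod_comp, Fintype.prod_prod_type, Fintype.prod_bool,
    mul_comm]
  simp [glue, Fin.snocEquiv]

variable [MeasurableSpace X]

theorem measurable_diag (hS : Measurable S) : Measurable (diag k S) :=
  measurable_pi_lambda _ fun ε => hS.comp (measurable_pi_apply ε)

theorem measurable_side (i : Fin k) (hS : Measurable S) : Measurable (side i S) := by
  refine measurable_pi_lambda _ fun ε => ?_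
  unfold side
  split_ifs <;> fun_prop

end Glue

section Box

variable {X : Type*} [MeasurableSpace X] [StandardBorelSpace X] {μ : Measure X}
  [IsProbabilityMeasure μ] {k : ℕ}

instance isProbabilityMeasure_boxMeasure (μ : Measure X) [IsProbabilityMeasure μ]
    (T : Fin k → X → X) : IsProbabilityMeasure (boxMeasure μ T) :=
  (boxProbabilityMeasure μ k T).2

theorem measurePreserving_const_boxMeasure (μ : Measure X) [IsProbabilityMeasure μ]
    (T : Fin 0 → X → X) :
    MeasurePreserving (fun (x : X) (_ : Fin 0 → Bool) => x) μ (boxMeasure μ T) :=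
  ⟨measurable_pi_lambda _ fun _ => measurable_id, rfl⟩

theorem measurePreserving_glue (μ : Measure X) [IsProbabilityMeasure μ]
    (T : Fin (k + 1) → X → X) :
    MeasurePreserving glue
      (condIndepSquare (boxMeasure μ fun i => T i.castSucc) (diag k (T (Fin.last k))))
      (boxMeasure μ T) :=
  ⟨measurable_glue, rfl⟩

theorem measurePreserving_apply (μ : Measure X) [IsProbabilityMeasure μ] (T : Fin k → X → X)
    (ε : Fin k → Bool) : MeasurePreserving (fun x => x ε) (boxMeasure μ T) μ := by
  induction k with
  | zero =>
    exact .map_of_comp (MeasurePreserving.id μ) (measurable_pi_apply ε)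
      (measurePreserving_const_boxMeasure μ T).measurable
  | succ k ih =>
    refine .map_of_comp ?_ (measurable_pi_apply ε) measurable_glue
    by_cases h : ε (Fin.last k)
    · have hsnd : (fun x : (Fin (k + 1) → Bool) → X => x ε) ∘ glue =
          (fun x => x (Fin.init ε)) ∘ Prod.snd := by
        funext p
        simp [glue, h]
      exact hsnd ▸ (ih _ _).comp (measurePreserving_snd _ _)
    · have hfst : (fun x : (Fin (k + 1) → Bool) → X => x ε) ∘ glue =
          (fun x => x (Fin.init ε)) ∘ Prod.fst := by
        funext p
        simp [glue, h]
      exact hfst ▸ (ih _ _).comp (measurePreserving_fst _ _)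

theorem measurePreserving_diag {T : Fin k → X → X} (hT : ∀ i, MeasurePreserving (T i) μ μ)
    (hcomm : ∀ i j, Function.Commute (T i) (T j)) {S : X → X} (hS : MeasurePreserving S μ μ)
    (hST : ∀ i, Function.Commute S (T i)) :
    MeasurePreserving (diag k S) (boxMeasure μ T) (boxMeasure μ T) := by
  induction k generalizing S with
  | zero =>
    exact .of_semiconj (measurePreserving_const_boxMeasure μ T) hS (fun _ => rfl)
      (measurable_diag hS.measurable)
  | succ k ih =>
    have ih' := @ih (fun i => T i.castSucc) (fun i => hT _) (fun i j => hcomm _ _)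
    exact .of_semiconj (measurePreserving_glue μ T)
      (measurePreserving_prodMap_self (ih' (hT _) fun i => hcomm _ _) (ih' hS fun i => hST _)
        (commute_diag (hST _)))
      (semiconj_glue_diag S) (measurable_diag hS.measurable)

theorem measurePreserving_diag_last {T : Fin (k + 1) → X → X}
    (hT : ∀ i, MeasurePreserving (T i) μ μ) (hcomm : ∀ i j, Function.Commute (T i) (T j)) :
    MeasurePreserving (diag k (T (Fin.last k))) (boxMeasure μ fun i => T i.castSucc)
      (boxMeasure μ fun i => T i.castSucc) :=
  measurePreserving_diag (fun _ => hT _) (fun _ _ => hcomm _ _) (hT _) fun _ => hcomm _ _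

theorem measurePreserving_side {T : Fin k → X → X} (hT : ∀ i, MeasurePreserving (T i) μ μ)
    (hcomm : ∀ i j, Function.Commute (T i) (T j)) (i : Fin k) :
    MeasurePreserving (side i (T i)) (boxMeasure μ T) (boxMeasure μ T) := by
  induction k with
  | zero => exact i.elim0
  | succ k ih =>
    have hlast := measurePreserving_diag_last hT hcomm
    refine Fin.lastCases ?_ (fun i => ?_) i
    · exact .of_semiconj (measurePreserving_glue μ T) (measurePreserving_prodMap_id hlast)
        (semiconj_glue_side_last _) (measurable_side _ (hT _).measurable)
    · exact .of_semiconj (measurePreserving_glue μ T)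
        (measurePreserving_prodMap_self hlast (ih (fun i => hT i.castSucc) (fun _ _ => hcomm _ _) i)
          (commute_side_diag i (hcomm _ _)))
        (semiconj_glue_side_castSucc i _) (measurable_side _ (hT _).measurable)

theorem comp_side_ae_eq_of_comp_glue_ae_eq_comp_fst {T : Fin (k + 1) → X → X}
    (hT : ∀ i, MeasurePreserving (T i) μ μ) (hcomm : ∀ i j, Function.Commute (T i) (T j))
    {F : ((Fin (k + 1) → Bool) → X) → ℝ} {G : ((Fin k → Bool) → X) → ℝ} (hG : Measurable G)
    (hFG : F ∘ glue =ᵐ[condIndepSquare (boxMeasure μ fun i => T i.castSucc)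
      (diag k (T (Fin.last k)))] G ∘ Prod.fst)
    (i : Fin k) (hinv : F ∘ side i.castSucc (T i.castSucc) =ᵐ[boxMeasure μ T] F) :
    G ∘ side i (T i.castSucc) =ᵐ[boxMeasure μ fun i => T i.castSucc] G := by
  have hside := measurePreserving_side (fun i => hT (Fin.castSucc i)) (fun _ _ => hcomm _ _) i
  have hsides := measurePreserving_prodMap_self (measurePreserving_diag_last hT hcomm) hside
    (commute_side_diag i (hcomm _ _))
  have hglue_inv := (measurePreserving_glue μ T).quasiMeasurePreserving.ae_eq_comp hinv
  rw [Function.comp_assoc, ← (semiconj_glue_side_castSucc i _).comp_eq] at hglue_inv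
  rw [← ae_eq_comp_iff_of_measurePreserving (measurePreserving_fst _ (diag k (T (Fin.last k))))
    (hG.comp hside.measurable).aestronglyMeasurable hG.aestronglyMeasurable]
  exact ((hsides.quasiMeasurePreserving.ae_eq_comp hFG).symm.trans hglue_inv).trans hFG

theorem exists_ae_eq_comp_zeroIndex_of_side_invariant {T : Fin k → X → X}
    (hT : ∀ i, MeasurePreserving (T i) μ μ) (hcomm : ∀ i j, Function.Commute (T i) (T j))
    {F : ((Fin k → Bool) → X) → ℝ} (hF : MemLp F ∞ (boxMeasure μ T))
    (hinv : ∀ i, F ∘ side i (T i) =ᵐ[boxMeasure μ T] F) :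
    ∃ G : X → ℝ, Measurable G ∧ F =ᵐ[boxMeasure μ T] G ∘ fun x => x (zeroIndex k) := by
  induction k with
  | zero =>
    refine ⟨fun x => hF.1.mk F fun _ => x, hF.1.stronglyMeasurable_mk.measurable.comp
      (measurable_pi_lambda _ fun _ => measurable_id), hF.1.ae_eq_mk.trans (.of_forall fun x => ?_)⟩
    refine congrArg _ (funext fun ε => ?_)
    rw [Subsingleton.elim ε (zeroIndex 0)]
  | succ k ih =>
    have hglue := measurePreserving_glue μ T
    have hfst := measurePreserving_fst (boxMeasure μ fun i => T i.castSucc)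
      (diag k (T (Fin.last k)))
    have hF_glue := hF.comp_measurePreserving hglue
    have hinv_last := hglue.quasiMeasurePreserving.ae_eq_comp (hinv (Fin.last k))
    rw [Function.comp_assoc, ← (semiconj_glue_side_last _).comp_eq] at hinv_last
    obtain ⟨F', hF', hFF'⟩ :=
      exists_ae_eq_comp_fst (measurePreserving_diag_last hT hcomm) hF_glue hinv_last
    have hF'_memLp : MemLp F' ∞ (boxMeasure μ fun i => T i.castSucc) := by
      rw [← hfst.map_eq, memLp_map_measure_iff hF'.aestronglyMeasurable hfst.aemeasurable]
      exact hF_glue.ae_eq hFF'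
    obtain ⟨G, hG, hF'G⟩ := ih (fun i => hT i.castSucc) (fun _ _ => hcomm _ _) hF'_memLp fun i =>
      comp_side_ae_eq_of_comp_glue_ae_eq_comp_fst hT hcomm hF' hFF' i (hinv _)
    refine ⟨G, hG, ?_⟩
    rw [← ae_eq_comp_iff_of_measurePreserving hglue hF.1
      (hG.comp (measurable_pi_apply _)).aestronglyMeasurable]
    have hzero : (G ∘ fun x => x (zeroIndex (k + 1))) ∘ glue =
        (G ∘ fun x => x (zeroIndex k)) ∘ Prod.fst := rfl
    rw [hzero]
    exact hFF'.trans (hfst.quasiMeasurePreserving.ae_eq_comp hF'G)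

theorem memLp_prod_apply {f : (Fin k → Bool) → X → ℝ} (hf : ∀ ε, MemLp (f ε) ∞ μ)
    (T : Fin k → X → X) : MemLp (fun x => ∏ ε, f ε (x ε)) ∞ (boxMeasure μ T) := by
  have h := MemLp.prod' (s := Finset.univ) (p := fun _ => ∞) fun ε _ =>
    (hf ε).comp_measurePreserving (measurePreserving_apply μ T ε)
  simpa using h

theorem abs_prod_apply_le_one {f : (Fin k → Bool) → X → ℝ} (hf : ∀ ε, ∀ᵐ x ∂μ, |f ε x| ≤ 1)
    (T : Fin k → X → X) : ∀ᵐ x ∂(boxMeasure μ T), |∏ ε, f ε (x ε)| ≤ 1 := by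
  filter_upwards [ae_all_iff.2 fun ε =>
    (measurePreserving_apply μ T ε).quasiMeasurePreserving.ae (hf ε)] with x hx
  rw [Finset.abs_prod]
  exact Finset.prod_le_one (fun _ _ => abs_nonneg _) fun ε _ => hx ε

theorem integral_boxMeasure_succ (T : Fin (k + 1) → X → X)
    {f : (Fin (k + 1) → Bool) → X → ℝ} (hf : ∀ ε, MemLp (f ε) ∞ μ) :
    ∫ x, ∏ ε, f ε (x ε) ∂(boxMeasure μ T) =
      ∫ p, (∏ η : Fin k → Bool, f (Fin.snoc η false) (p.1 η)) *
        (∏ η : Fin k → Bool, f (Fin.snoc η true) (p.2 η))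
        ∂(condIndepSquare (boxMeasure μ fun i => T i.castSucc) (diag k (T (Fin.last k)))) := by
  rw [← integral_comp_of_measurePreserving (measurePreserving_glue μ T) (memLp_prod_apply hf T).1]
  simp_rw [prod_glue]

theorem integral_boxMeasure_prod_self_nonneg {f : X → ℝ} (hf : MemLp f ∞ μ)
    (T : Fin (k + 1) → X → X) : 0 ≤ ∫ x, ∏ ε, f (x ε) ∂(boxMeasure μ T) := by
  rw [integral_boxMeasure_succ T fun _ => hf]
  exact integral_condIndepSquare_self_nonneg _ (memLp_prod_apply (fun _ => hf) _)

theorem integral_boxMeasure_prod_pow_le {T : Fin k → X → X} (hT : ∀ i, MeasurePreserving (T i) μ μ)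
    (hcomm : ∀ i j, Function.Commute (T i) (T j)) {f : (Fin k → Bool) → X → ℝ}
    (hf : ∀ ε, MemLp (f ε) ∞ μ) (hf1 : ∀ ε, ε ≠ zeroIndex k → ∀ᵐ x ∂μ, |f ε x| ≤ 1) :
    (∫ x, ∏ ε, f ε (x ε) ∂(boxMeasure μ T)) ^ 2 ^ k ≤
      ∫ x, ∏ ε, f (zeroIndex k) (x ε) ∂(boxMeasure μ T) := by
  induction k with
  | zero =>
    rw [pow_zero, pow_one]
    refine le_of_eq (congrArg _ (funext fun x => Finset.prod_congr rfl fun ε _ => ?_))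
    rw [Subsingleton.elim ε (zeroIndex 0)]
  | succ k ih =>
    set ν := boxMeasure μ fun i => T i.castSucc
    set S := T (Fin.last k)
    have hS : MeasurePreserving (diag k S) ν ν := measurePreserving_diag_last hT hcomm
    set f₀ : (Fin k → Bool) → X → ℝ := fun η => f (Fin.snoc η false)
    set f₁ : (Fin k → Bool) → X → ℝ := fun η => f (Fin.snoc η true)
    set g := f (zeroIndex (k + 1))
    have hf₀ : MemLp (fun y => ∏ η, f₀ η (y η)) ∞ ν := memLp_prod_apply (fun η => hf _) _
    have hf₁ : MemLp (fun y => ∏ η, f₁ η (y η)) ∞ ν := memLp_prod_apply (fun η => hf _) _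
    have hg : MemLp (fun y : (Fin k → Bool) → X => ∏ η, g (y η)) ∞ ν :=
      memLp_prod_apply (fun _ => hf _) _
    have hf₁_le : ∀ᵐ y ∂ν, |∏ η, f₁ η (y η)| ≤ 1 :=
      abs_prod_apply_le_one (fun η => hf1 _ (snoc_true_ne_zeroIndex η)) _
    have hiterate : ∀ n, (∫ y, (∏ η, f₀ η ((diag k S)^[n] y η)) * ∏ η, f₀ η (y η) ∂ν) ^ 2 ^ k ≤
        ∫ y, (∏ η, g ((diag k S)^[n] y η)) * ∏ η, g (y η) ∂ν := by
      intro n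
      have hSn : MeasurePreserving S^[n] μ μ := (hT _).iterate n
      have h := ih (fun i => hT i.castSucc) (fun _ _ => hcomm _ _)
        (f := fun η x => f₀ η (S^[n] x) * f₀ η x)
        (fun η => (hf _).mul ((hf _).comp_measurePreserving hSn)) fun η hη => by
          have hle : ∀ᵐ x ∂μ, |f₀ η x| ≤ 1 := hf1 _ (snoc_false_ne_zeroIndex hη)
          filter_upwards [hle, hSn.quasiMeasurePreserving.ae hle] with x hx hSx
          rw [abs_mul]
          exact mul_le_one₀ hSx (abs_nonneg _) hx
      simpa only [f₀, snoc_zeroIndex_false, Finset.prod_mul_distrib, iterate_diag, diag] using h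
    rw [integral_boxMeasure_succ T hf, integral_boxMeasure_succ T (f := fun _ => g) fun _ => hf _,
      pow_succ', pow_mul]
    exact (pow_le_pow_left₀ (sq_nonneg _) (integral_condIndepSquare_sq_le _ hf₀ hf₁ hf₁_le) _).trans
      (integral_condIndepSquare_self_pow_le hS k hf₀ hg hiterate)

end Box

section Characteristic

variable {X : Type*} [MeasurableSpace X] {d : ℕ}

/-- The σ-algebra on `X^*` generated by `x ↦ x^♯`. -/
abbrev sigmaSharp (d : ℕ) (X : Type*) [MeasurableSpace X] :
    MeasurableSpace ((Fin d → Bool) → X) :=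
  .comap sharp (inferInstance : MeasurableSpace (Sharp d X))

theorem sigmaSharp_le : sigmaSharp d X ≤ MeasurableSpace.pi :=
  Measurable.comap_le (measurable_pi_lambda _ fun ε => measurable_pi_apply ε.1)

theorem measurable_sigmaSharp_apply (ε : {ε : Fin d → Bool // ε ≠ zeroIndex d}) :
    Measurable[sigmaSharp d X] fun x : (Fin d → Bool) → X => x ε :=
  (measurable_pi_apply (X := fun _ => X) ε).comp (comap_measurable sharp)

theorem measurable_side_sigmaSharp (i : Fin d) {S : X → X} (hS : Measurable S) :
    Measurable[sigmaSharp d X, sigmaSharp d X] (side i S) := by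
  refine measurable_comap_iff.2 (@measurable_pi_lambda _ _ _ (sigmaSharp d X) _ _ fun ε => ?_)
  by_cases h : ε.1 i
  · simpa [Function.comp_def, sharp, side, h] using hS.comp (measurable_sigmaSharp_apply ε)
  · simpa [Function.comp_def, sharp, side, h] using measurable_sigmaSharp_apply ε

variable [StandardBorelSpace X] {μ : Measure X} [IsProbabilityMeasure μ] {T : Fin d → X → X}
  {f : X → ℝ}

theorem setIntegral_sharp_preimage_pi_eq_zero (hd : 1 ≤ d)
    (hT : ∀ i, MeasurePreserving (T i) μ μ) (hcomm : ∀ i j, Function.Commute (T i) (T j))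
    (hf : MemLp f ∞ μ) (h : ∫ x, ∏ ε, f (x ε) ∂(boxMeasure μ T) = 0)
    {t : {ε : Fin d → Bool // ε ≠ zeroIndex d} → Set X} (ht : ∀ ε, MeasurableSet (t ε)) :
    ∫ x in sharp ⁻¹' Set.univ.pi t, f (x (zeroIndex d)) ∂(boxMeasure μ T) = 0 := by
  classical
  have hmeas : MeasurableSet (sharp ⁻¹' Set.univ.pi t) :=
    sigmaSharp_le _ ⟨_, .univ_pi ht, rfl⟩
  set F : (Fin d → Bool) → X → ℝ := fun ε =>
    if hε : ε ≠ zeroIndex d then (t ⟨ε, hε⟩).indicator 1 else f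
  have hF_memLp : ∀ ε, MemLp (F ε) ∞ μ := fun ε => by
    by_cases hε : ε = zeroIndex d
    · simpa [F, hε] using hf
    · simpa only [F, dif_pos hε] using
        (show MemLp 1 ∞ μ from memLp_const (1 : ℝ)).indicator (ht ⟨ε, hε⟩)
  have hF_le : ∀ ε, ε ≠ zeroIndex d → ∀ᵐ x ∂μ, |F ε x| ≤ 1 := fun ε hε => .of_forall fun x => by
    by_cases hx : x ∈ t ⟨ε, hε⟩ <;> simp [F, hε, hx]
  have hF_zero : F (zeroIndex d) = f := by simp [F]
  have hprod : ∀ x, ∏ ε, F ε (x ε) =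
      (sharp ⁻¹' Set.univ.pi t).indicator (fun x => f (x (zeroIndex d))) x := fun x => by
    have hF_sharp : ∀ ε : {ε : Fin d → Bool // ε ≠ zeroIndex d},
        F ε (x ε) = (t ε).indicator 1 (sharp x ε) := fun ε => by simp [F, ε.2, sharp]
    rw [Fintype.prod_eq_mul_prod_subtype_ne _ (zeroIndex d), hF_zero]
    simp_rw [hF_sharp, ← Set.indicator_pi_one_apply, Finset.coe_univ]
    by_cases hx : sharp x ∈ Set.univ.pi t <;> simp [Set.indicator, hx]
  have hpow := integral_boxMeasure_prod_pow_le hT hcomm hF_memLp hF_le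
  simp only [hF_zero, h, hprod] at hpow
  rw [← integral_indicator hmeas]
  have heven : Even (2 ^ d) := Nat.even_pow.2 ⟨even_two, by omega⟩
  exact (pow_eq_zero_iff (by positivity)).1 (le_antisymm hpow (heven.pow_nonneg _))

theorem condExp_sigmaSharp_ae_eq_zero_iff (hd : 1 ≤ d)
    (hT : ∀ i, MeasurePreserving (T i) μ μ) (hcomm : ∀ i j, Function.Commute (T i) (T j))
    (hf : MemLp f ∞ μ) :
    (boxMeasure μ T)[fun x => f (x (zeroIndex d)) | sigmaSharp d X] =ᵐ[boxMeasure μ T] 0 ↔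
      ∫ x, ∏ ε, f (x ε) ∂(boxMeasure μ T) = 0 := by
  have hf_zero := (hf.comp_measurePreserving (measurePreserving_apply μ T (zeroIndex d))).integrable
    le_top
  constructor
  · intro hcond
    have hf_sharp : AEStronglyMeasurable[sigmaSharp d X]
        (fun x => ∏ ε : {ε : Fin d → Bool // ε ≠ zeroIndex d}, f (x ε)) (boxMeasure μ T) :=
      ⟨_, Finset.stronglyMeasurable_fun_prod _ fun ε _ =>
          hf.1.stronglyMeasurable_mk.comp_measurable (measurable_sigmaSharp_apply ε), by
        filter_upwards [ae_all_iff.2 fun ε =>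
          (measurePreserving_apply μ T ε).quasiMeasurePreserving.ae hf.1.ae_eq_mk] with x hx
        exact Finset.prod_congr rfl fun ε _ => hx ε⟩
    simp_rw [fun x : (Fin d → Bool) → X =>
      Fintype.prod_eq_mul_prod_subtype_ne (fun ε => f (x ε)) (zeroIndex d)]
    refine integral_mul_eq_zero_of_condExp_ae_eq_zero sigmaSharp_le hf_zero hcond hf_sharp ?_
    convert (memLp_prod_apply (fun _ => hf) T).integrable le_top using 1
    funext x
    exact (Fintype.prod_eq_mul_prod_subtype_ne (fun ε => f (x ε)) (zeroIndex d)).symm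
  · intro h
    have hset := fun t ht => setIntegral_sharp_preimage_pi_eq_zero (t := t) hd hT hcomm hf h ht
    refine condExp_ae_eq_zero_of_generateFrom sigmaSharp_le (isPiSystem_pi.comap sharp)
      ?_ hf_zero ?_ ?_
    · rw [sigmaSharp, ← generateFrom_pi, MeasurableSpace.comap_generateFrom]
      rfl
    · simpa using hset (fun _ => Set.univ) fun _ => .univ
    · rintro _ ⟨_, ⟨t, ht, rfl⟩, rfl⟩
      exact hset t fun ε => ht ε trivial

theorem sigmaZ_le (μ : Measure X) [IsProbabilityMeasure μ] (T : Fin d → X → X) :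
    sigmaZ μ T ≤ ‹MeasurableSpace X› :=
  fun _ h => h.1

theorem measurable_sigmaZ_of_comp_ae_eq {G : X → ℝ} (hG : Measurable G) {Φ : Sharp d X → ℝ}
    (hΦ : Measurable Φ) (h : Φ ∘ sharp =ᵐ[boxMeasure μ T] G ∘ fun x => x (zeroIndex d)) :
    Measurable[sigmaZ μ T] G := by
  intro s hs
  refine ⟨hG hs, Φ ⁻¹' s, hΦ hs, ?_⟩
  rw [agreesWith_iff]
  filter_upwards [h] with x hx
  exact Iff.of_eq (congrArg (· ∈ s) hx.symm)

theorem ae_eq_condExp_sigmaZ (hf : Integrable f μ) {G : X → ℝ} (hG : Measurable[sigmaZ μ T] G)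
    (h : (boxMeasure μ T)[fun x => f (x (zeroIndex d)) | sigmaSharp d X] =ᵐ[boxMeasure μ T]
      G ∘ fun x => x (zeroIndex d)) :
    G =ᵐ[μ] μ[f | sigmaZ μ T] := by
  have hzero := measurePreserving_apply μ T (zeroIndex d)
  have hGm := (hG.mono (sigmaZ_le μ T) le_rfl).aestronglyMeasurable (μ := μ)
  have hGi : Integrable G μ := by
    rw [← hzero.integrable_comp hGm]
    exact integrable_condExp.congr h
  refine ae_eq_condExp_of_forall_setIntegral_eq (sigmaZ_le μ T) hf
    (fun _ _ _ => hGi.integrableOn) (fun B hB _ => ?_) hG.aestronglyMeasurable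
  obtain ⟨hBm, A, hA, hBA⟩ := hB
  set P := boxMeasure μ T
  set B' : Set ((Fin d → Bool) → X) := (fun x => x (zeroIndex d)) ⁻¹' B
  have hsets : B' =ᵐ[P] sharp ⁻¹' A := eventuallyEq_set.2 ((agreesWith_iff μ T B A).1 hBA)
  have hrestrict := hzero.restrict_preimage hBm
  calc ∫ y in B, G y ∂μ = ∫ x in B', G (x (zeroIndex d)) ∂P :=
        (integral_comp_of_measurePreserving hrestrict hGm.restrict).symm
    _ = ∫ x in B', (P[fun x => f (x (zeroIndex d)) | sigmaSharp d X]) x ∂P :=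
        (integral_congr_ae (ae_restrict_of_ae h)).symm
    _ = ∫ x in sharp ⁻¹' A, (P[fun x => f (x (zeroIndex d)) | sigmaSharp d X]) x ∂P :=
        setIntegral_congr_set hsets
    _ = ∫ x in sharp ⁻¹' A, f (x (zeroIndex d)) ∂P :=
        setIntegral_condExp sigmaSharp_le (hzero.integrable_comp_of_integrable hf) ⟨A, hA, rfl⟩
    _ = ∫ x in B', f (x (zeroIndex d)) ∂P := (setIntegral_congr_set hsets).symm
    _ = ∫ y in B, f y ∂μ := integral_comp_of_measurePreserving hrestrict hf.1.restrict

theorem condExp_sigmaSharp_ae_eq (hT : ∀ i, MeasurePreserving (T i) μ μ)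
    (hcomm : ∀ i j, Function.Commute (T i) (T j)) (hf : MemLp f ∞ μ) :
    (boxMeasure μ T)[fun x => f (x (zeroIndex d)) | sigmaSharp d X] =ᵐ[boxMeasure μ T]
      μ[f | sigmaZ μ T] ∘ fun x => x (zeroIndex d) := by
  have hzero := measurePreserving_apply μ T (zeroIndex d)
  have hf_zero := hf.comp_measurePreserving hzero
  obtain ⟨G, hG, hG_condExp⟩ := exists_ae_eq_comp_zeroIndex_of_side_invariant hT hcomm
    (hf_zero.condExp (m := sigmaSharp d X) le_top) fun i =>
      condExp_comp_ae_eq_of_comp_ae_eq sigmaSharp_le (measurePreserving_side hT hcomm i)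
        (measurable_side_sigmaSharp i (hT i).measurable) (hf_zero.mono_exponent le_top)
        (.of_forall fun x => congrArg f (side_zeroIndex i (T i) x))
  obtain ⟨Φ, hΦ, hΦ_condExp⟩ := (stronglyMeasurable_condExp (m := sigmaSharp d X)
    (μ := boxMeasure μ T) (f := fun x => f (x (zeroIndex d)))).measurable.exists_eq_measurable_comp
  have hG_sigmaZ := measurable_sigmaZ_of_comp_ae_eq hG hΦ (hΦ_condExp ▸ hG_condExp)
  exact hG_condExp.trans (hzero.quasiMeasurePreserving.ae_eq_comp
    (ae_eq_condExp_sigmaZ (hf.integrable le_top) hG_sigmaZ hG_condExp))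

theorem boxSeminorm_eq_zero_iff (hd : 1 ≤ d) (T : Fin d → X → X) (hf : MemLp f ∞ μ) :
    boxSeminorm μ T f = 0 ↔ ∫ x, ∏ ε, f (x ε) ∂(boxMeasure μ T) = 0 := by
  obtain ⟨k, rfl⟩ := Nat.exists_eq_add_of_le' hd
  exact Real.rpow_eq_zero (integral_boxMeasure_prod_self_nonneg hf T) (by positivity)

end Characteristic

end BoxSeminorm

theorem lemma2p7 {X : Type*} [MeasurableSpace X] [StandardBorelSpace X]
    (μ : Measure X) [IsProbabilityMeasure μ] {d : ℕ} (hd : 1 ≤ d)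
    (T : Fin d → X → X) (hT : ∀ i, MeasurePreserving (T i) μ μ)
    (hcomm : ∀ i j, Function.Commute (T i) (T j))
    (f : X → ℝ) (hf : MemLp f ∞ μ) :
    BoxSeminorm.boxSeminorm μ T f = 0 ↔
      μ[f | BoxSeminorm.sigmaZ μ T] =ᵐ[μ] 0 := by
  open BoxSeminorm in
  have hcondExp := condExp_sigmaSharp_ae_eq hT hcomm hf
  rw [boxSeminorm_eq_zero_iff hd T hf, ← condExp_sigmaSharp_ae_eq_zero_iff hd hT hcomm hf,
    ← ae_eq_comp_iff_of_measurePreserving (measurePreserving_apply μ T (zeroIndex d))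
      integrable_condExp.1 aestronglyMeasurable_zero]
  exact ⟨hcondExp.symm.trans, hcondExp.trans⟩
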